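/- All graphs are finite, simple and undirected unless called directed. For a graph $G$ and $S\subseteq V(G)$, let $N_G(S)$ be the closed neighbourhood of $S$ (that is, $S$ together with all neighbours of vertices of $S$), let $G[S]$ be the subgraph induced by $S$, and let $$h(G)=\min\Big\{\frac{|\{e\in E(G):|e\cap S|=1\}|}{|S|} : \emptyset\neq S\subseteq V(G),\ |S|\le |V(G)|/2\Big\}$$ be the expansion ratio. Let $\mathcal C_k$ be the class of graphs of maximum degree at most $k$. For $\delta\in(0,1]$, a graph $G\in\mathcal C_k$ is \emph{$\delta$-locally Hamiltonian on $\mathcal C_k$} if for every $S\subseteq V(G)$ with $|S|\le\delta|V(G)|$ there are a Hamiltonian graph $H\in\mathcal C_k$ with $|V(H)|=|V(G)|$, a set $T\subseteq V(H)$ and an isomorphism from $G[N_G(S)]$ to $H[N_H(T)]$ that maps $S$ onto $T$. Construction. Let $\mathcal E$ be a $d$-regular graph, let $\vec E$ be the set of directed edges obtained by replacing each edge $\{u,v\}$ of $\mathcal E$ by $(u,v)$ and $(v,u)$, and let $f:\vec E\to\{1,\dots,|\vec E|\}$ be any bijection. The graph $G_{\mathcal E}$ has the $31|\vec E|+6|V(\mathcal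 E)|$ distinct vertices $a_1^e,\dots,a_{31}^e$ ($e\in\vec E$) and $b_1^v,\dots,b_6^v$ ($v\in V(\mathcal E)$), and exactly the following edges: (i) for every $e\in\vec E$: $\{a_i^e,a_{i+1}^e\}$ for $1\le i\le 30$, $\{a_j^e,a_{j+3}^e\}$ for $j\in\{2,27\}$, and $\{a_k^e,a_{k+5}^e\}$ for $k\in\{6,12,15,21\}$; (ii) $\{a_{31}^{f^{-1}(i)},a_1^{f^{-1}(i+1)}\}$ for $1\le i\le|\vec E|$, where $i+1$ is read as $1$ if $i=|\vec E|$; (iii) for all $e=(u,v)\in\vec E$ and $e'=(v,w)\in\vec E$ (with $w=u$ allowed): $\{a_{23}^{e},a_3^{e'}\}$, $\{a_{18}^{e},a_8^{e'}\}$, $\{a_{29}^{e},a_9^{e'}\}$, $\{a_{24}^{e},a_{14}^{e'}\}$, $\{a_5^{e'},b_1^v\}$, $\{b_1^v,b_2^v\}$, $\{b_2^v,b_3^v\}$, $\{b_3^v,a_{23}^{e}\}$, $\{a_{24}^{e},b_4^v\}$, $\{b_4^v,b_5^v\}$, $\{b_5^v,b_6^v\}$, $\{b_6^v,a_{12}^{e'}\}$.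 Theorem. Let $d\ge 2$, let $\mathcal E$ be a non-empty $d$-regular graph with $h(\mathcal E)\ge 1$, let $f$ be any bijection as above, and let $\delta=\frac{1}{2(6+31d)}$. Then $G_{\mathcal E}$ is $\delta$-locally Hamiltonian on $\mathcal C_{d+3}$. Moreover, for every $S\subseteq V(G_{\mathcal E})$ with $|S|\le\delta|V(G_{\mathcal E})|$ there is a Hamiltonian graph $H\in\mathcal C_{d+3}$ that arises from $G_{\mathcal E}$ by adding edges, none of which is incident to a vertex of $S$ or has both ends in $N_{G_{\mathcal E}}(S)$. -/

import Mathlib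

universe u

open scoped Classical in
/-- The number of edges of `G` with exactly one end in `S`. -/
noncomputable def edgeBoundaryCard {V : Type u} [Fintype V] (G : SimpleGraph V)
    (S : Finset V) : ℕ :=
  (G.edgeFinset.filter (fun e => (S.filter (fun v => v ∈ e)).card = 1)).card

/-- The expansion ratio `h(G)`: the minimum of `|∂S| / |S|` over the nonempty sets `S` of at most
half of the vertices. (The infimum is over a finite family, which is nonempty as soon as `G` has
at least two vertices.) -/
noncomputable def expansionRatio {V : Type u} [Fintype V] (G : SimpleGraph V) : ℝ :=
  ⨅ S : {S : Finset V // S.Nonempty ∧ 2 * S.card ≤ Fintype.card V},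
    (edgeBoundaryCard G S.1 : ℝ) / (S.1.card : ℝ)

/-- The closed neighbourhood `N_G(S)`. -/
def closedNbhd {V : Type u} (G : SimpleGraph V) (S : Set V) : Set V :=
  S ∪ {v | ∃ w ∈ S, G.Adj w v}

/-- A class of finite graphs. -/
def GraphClass : Type (u + 1) := (W : Type u) → [Fintype W] → SimpleGraph W → Prop

/-- The class of the finite graphs of maximum degree at most `d`. -/
def boundedDegree (d : ℕ) : GraphClass.{u} := fun _W _ G => ∀ v, (G.neighborSet v).ncard ≤ d

open scoped Classical in
/-- `G` is `δ`-locally Hamiltonian on the class `C`, for `δ ∈ (0, 1]`. -/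
def IsLocallyHamiltonianOn (C : GraphClass.{u}) (δ : ℝ) {V : Type u} [Fintype V]
    (G : SimpleGraph V) : Prop :=
  0 < δ ∧ δ ≤ 1 ∧ C V G ∧
    ∀ S : Finset V, (S.card : ℝ) ≤ δ * (Fintype.card V : ℝ) →
      ∃ (W : Type u) (_ : Fintype W) (H : SimpleGraph W),
        C W H ∧ H.IsHamiltonian ∧ Fintype.card W = Fintype.card V ∧
        ∃ (T : Set W)
          (φ : G.induce (closedNbhd G (S : Set V)) ≃g H.induce (closedNbhd H T)),
          (fun x => (φ x : W)) '' {x | (x : V) ∈ S} = T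

/-- The edge set of the path gadget `P(v 1, …, v 31)`. -/
def pathGadgetEdges {X : Type u} (v : ℕ → X) : Set (Sym2 X) :=
  {e | ∃ i ∈ Set.Icc 1 30, e = s(v i, v (i + 1))} ∪
  {e | ∃ j ∈ ({2, 27} : Set ℕ), e = s(v j, v (j + 3))} ∪
  {e | ∃ k ∈ ({6, 12, 15, 21} : Set ℕ), e = s(v k, v (k + 5))}

/-- The edges of a link from `P(u 1, …, u 31)` to `P(v 1, …, v 31)` via `w 1, …, w 6`. -/
def linkEdges {X : Type u} (u v w : ℕ → X) : Set (Sym2 X) :=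
  {s(u 23, v 3), s(u 18, v 8), s(u 29, v 9), s(u 24, v 14),
   s(v 5, w 1), s(w 1, w 2), s(w 2, w 3), s(w 3, u 23),
   s(u 24, w 4), s(w 4, w 5), s(w 5, w 6), s(w 6, v 12)}

/-- The vertices of the graph built from the base graph `E`: 31 vertices for each directed edge
(dart) of `E` and 6 vertices for each vertex of `E`. -/
abbrev GadgetVertex {V : Type u} (E : SimpleGraph V) : Type u :=
  (E.Dart × Fin 31) ⊕ (V × Fin 6)

/-- The vertex `a_i^e`, for `1 ≤ i ≤ 31`; the index `i` is stored as `i - 1`. -/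
def aVertex {V : Type u} (E : SimpleGraph V) (e : E.Dart) (i : ℕ) : GadgetVertex E :=
  Sum.inl (e, Fin.ofNat 31 (i - 1))

/-- The vertex `b_i^v`, for `1 ≤ i ≤ 6`; the index `i` is stored as `i - 1`. -/
def bVertex {V : Type u} (E : SimpleGraph V) (v : V) (i : ℕ) : GadgetVertex E :=
  Sum.inr (v, Fin.ofNat 6 (i - 1))

/-- The graph `G_E` built from the base graph `E` and an enumeration `f` of its directed edges:
a path gadget on each directed edge, an edge from the end of each gadget to the beginning of the
cyclically next one, and a link from the gadget of `(u, v)` to that of `(v, w)` via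
`b_1^v, …, b_6^v` for all directed edges `(u, v)` and `(v, w)`. -/
def gadgetGraph {V : Type u} [Fintype V] [DecidableEq V] (E : SimpleGraph V)
    [DecidableRel E.Adj] (f : E.Dart ≃ Fin (Fintype.card E.Dart)) :
    SimpleGraph (GadgetVertex E) :=
  SimpleGraph.fromEdgeSet
    ({x | ∃ e : E.Dart, x ∈ pathGadgetEdges (aVertex E e)} ∪
     {x | ∃ i : Fin (Fintype.card E.Dart),
        x = s(aVertex E (f.symm i) 31, aVertex E (f.symm (finRotate _ i)) 1)} ∪
     {x | ∃ e e' : E.Dart, e.snd = e'.fst ∧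
        x ∈ linkEdges (aVertex E e) (aVertex E e') (bVertex E e.snd)})

/-!
Write `a_i^e` and `b_i^v` for the vertices of the gadget graph, and say that `a_i^e` belongs to the
vertex where the dart `e` starts and `b_i^v` to `v`. Let `X` be the set of the vertices of `E` to
which some vertex of `S` belongs. The value of `δ` is chosen so that `|X| ≤ |S| ≤ |V(E)| / 2`.

*Routing.* By the expansion of `E`, each subset `X'` of `X` has at least `|X'|` boundary edges. By
Hall's theorem, the darts can therefore be shared out so that each `v ∈ X` gets `d + 1` of the `2 d`
darts incident to it (`exists_dart_allocation`). Orienting towards `v` the edges both of whose darts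
belong to `v` makes each `v ∈ X` entered more often than it is left, and after deleting superfluous
darts exactly once more (`exists_orientation_excess_one`). So the chosen darts form trails, one of
which ends in each `v ∈ X`, the others being closed, and which start outside `X` if they are not
closed. The trail that ends in `v` is prolonged by the reverse of its last dart (`exists_routing`).

*Hamiltonian cycle.* The gadgets, each traversed from `a_1^e` to `a_31^e` and joined in their cyclic
order, form a cycle that misses only the vertices `b_i^v`. A dart `e` on a trail exchanges vertices
with the next one, `e'`: the traversal of `e'` makes a detour through `a_21^e, …, a_26^e`, and that
of `e` makes one through `a_6^{e'}, …, a_11^{e'}`. The links allow this exchange. At the last dart of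
a trail, which starts at some `v ∈ X`, the detour passes through `b_1^v, …, b_6^v` as well. At
the first dart of a trail, which starts outside `X`, the added edge between `a_17^e` and `a_20^e`
replaces the exchange with a predecessor. For `v ∉ X`, three added edges allow `b_1^v, …, b_6^v` to
be inserted between `a_5^e` and `a_6^e` for some dart `e` starting at `v`. The traversals cover all
vertices, and their total length is the number of vertices, so they form a Hamiltonian cycle
(`Routing.augmentedGraph_isHamiltonian`).

*Locality.* Each added edge has both ends belonging to vertices outside `X`, and one of its ends has
only neighbours that belong to vertices outside `X` (`Routing.addedEdges_far`). So the added edges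
avoid `S`, and none of them has both ends in the closed neighbourhood of `S`. The degrees stay at
most `d + 3`, because the ends of the added edges have spare degree
(`Routing.card_nearby_le`).
-/

/-! ### Hamiltonian cycles from cyclic lists of vertices -/

/-- A closed chain of vertices that visits every vertex and is no longer than the number of
vertices visits every vertex once, so it is a Hamiltonian cycle. -/
theorem SimpleGraph.isHamiltonian_of_isChain {W : Type*} [Fintype W] [DecidableEq W]
    {G : SimpleGraph W} {l : List W} (hchain : l.IsChain G.Adj)
    (hclose : ∀ x ∈ l.getLast?, ∀ y ∈ l.head?, G.Adj x y) (hmem : ∀ x, x ∈ l)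
    (hlen : l.length ≤ Fintype.card W) (h3 : 3 ≤ Fintype.card W) : G.IsHamiltonian := by
  intro _
  have huniv : l.toFinset = Finset.univ := by ext; simp [hmem]
  have hnd : l.Nodup := by
    have h1 : l.toFinset.card = l.length :=
      le_antisymm (List.toFinset_card_le l) (by rw [huniv, Finset.card_univ]; exact hlen)
    exact Multiset.toFinset_card_eq_card_iff_nodup.1 h1
  have hl : l.length = Fintype.card W := by
    rw [← List.toFinset_card_of_nodup hnd, huniv, Finset.card_univ]
  have hne : l ≠ [] := by
    rintro rfl
    simp at hl
    omega
  let p := Walk.ofSupport l hne hchain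
  have hps : p.support = l := Walk.support_ofSupport hne hchain
  have hadj : G.Adj (l.getLast hne) (l.head hne) :=
    hclose _ (List.getLast?_eq_getLast_of_ne_nil hne) _ (List.head?_eq_some_head hne)
  refine ⟨_, Walk.cons hadj p, ?_⟩
  have hpp : p.IsPath := by rw [Walk.isPath_def, hps]; exact hnd
  rw [Walk.isHamiltonianCycle_iff_isCycle_and_support_count_tail_eq_one]
  constructor
  · rw [Walk.cons_isCycle_iff]
    refine ⟨hpp, fun h => ?_⟩
    -- a path whose ends are joined by one of its own edges has length one
    have h1 := hpp.length_eq_one_of_mem_edges (by rwa [Sym2.eq_swap] at h)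
    have h2 := p.length_support
    rw [hps] at h2
    omega
  · intro a
    rw [Walk.support_cons, List.tail_cons, hps]
    exact List.count_eq_one_of_mem hnd (hmem a)

/-- Joining nonempty chains in cyclic order gives a chain whose last element is again related to
its first one. -/
theorem List.isChain_flatten_ofFn_finRotate {α : Type*} {r : α → α → Prop} {n : ℕ}
    {T : Fin n → List α} (hne : ∀ i, T i ≠ []) (hT : ∀ i, (T i).IsChain r)
    (hr : ∀ i, ∀ x ∈ (T i).getLast?, ∀ y ∈ (T (finRotate n i)).head?, r x y) :
    (List.ofFn T).flatten.IsChain r ∧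
      ∀ x ∈ (List.ofFn T).flatten.getLast?, ∀ y ∈ (List.ofFn T).flatten.head?, r x y := by
  cases n with
  | zero => simp
  | succ N =>
    have hne' : [] ∉ List.ofFn T := by
      rw [List.mem_ofFn]
      rintro ⟨i, hi⟩
      exact hne i hi
    refine ⟨(List.isChain_flatten hne').2 ⟨?_, ?_⟩, fun x hx y hy => ?_⟩
    · intro l hl
      obtain ⟨i, rfl⟩ := List.mem_ofFn.1 hl
      exact hT i
    · rw [List.isChain_ofFn]
      intro i hi
      have := hr ⟨i, by omega⟩
      rwa [finRotate_of_lt (by omega)] at this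
    · have hx' : x ∈ (T (Fin.last N)).getLast? := by
        rw [List.ofFn_succ', List.concat_eq_append, List.flatten_append, List.flatten_singleton,
          List.getLast?_append_of_ne_nil _ (hne _)] at hx
        exact hx
      have hy' : y ∈ (T 0).head? := by
        rw [List.ofFn_succ, List.flatten_cons, List.head?_append_of_ne_nil _ (hne _)] at hy
        exact hy
      have := hr (Fin.last N) x hx' y
      rw [finRotate_last] at this
      exact this hy'

/-! ### Routing darts towards a set of vertices -/

section Flow

variable {V : Type u} [Fintype V] [DecidableEq V] {E : SimpleGraph V} [DecidableRel E.Adj]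

/-- The darts entering `X` from outside are at least as many as the edges with exactly one end
in `X`. -/
theorem edgeBoundaryCard_le_card_darts (X : Finset V) :
    edgeBoundaryCard E X ≤ (Finset.univ.filter fun e : E.Dart => e.fst ∉ X ∧ e.snd ∈ X).card := by
  classical
  unfold edgeBoundaryCard
  refine le_trans (Finset.card_le_card (t := Finset.image SimpleGraph.Dart.edge
    (Finset.univ.filter fun e : E.Dart => e.fst ∉ X ∧ e.snd ∈ X)) ?_) Finset.card_image_le
  intro z hz
  induction z with | _ x y
  simp only [Finset.mem_filter, SimpleGraph.mem_edgeFinset, SimpleGraph.mem_edgeSet] at hz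
  obtain ⟨hxy, hcard⟩ := hz
  simp only [Finset.mem_image, Finset.mem_filter, Finset.mem_univ, true_and]
  by_cases hx : x ∈ X <;> by_cases hy : y ∈ X
  · exfalso
    have : X.filter (fun v => v ∈ s(x, y)) = {x, y} := by
      ext v; simp only [Finset.mem_filter, Sym2.mem_iff, Finset.mem_insert, Finset.mem_singleton]
      constructor
      · exact fun h => h.2
      · rintro (rfl | rfl) <;> simp_all
    have h2 := Finset.card_pair hxy.ne
    rw [← this] at h2
    convert absurd (hcard.symm.trans _) (show (1 : ℕ) ≠ 2 by norm_num)
    convert h2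
  · exact ⟨⟨(y, x), hxy.symm⟩, ⟨hy, hx⟩, by simp [Sym2.eq_swap]⟩
  · exact ⟨⟨(x, y), hxy⟩, ⟨hx, hy⟩, rfl⟩
  · exfalso
    have : X.filter (fun v => v ∈ s(x, y)) = ∅ := by
      ext v; simp only [Finset.mem_filter, Sym2.mem_iff]
      constructor
      · rintro ⟨h, rfl | rfl⟩ <;> contradiction
      · simp
    have h2 := (congrArg Finset.card this).trans Finset.card_empty
    convert absurd (hcard.symm.trans _) (show (1 : ℕ) ≠ 0 by norm_num)
    convert h2

theorem card_darts_fst_eq_degree {d : ℕ} (hreg : E.IsRegularOfDegree d) (v : V) :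
    (Finset.univ.filter fun e : E.Dart => e.fst = v).card = d := by
  rw [E.dart_fst_fiber_card_eq_degree, hreg]

theorem card_darts_snd_eq_card_darts_fst (v : V) (p : E.Dart → Prop) [DecidablePred p] :
    (Finset.univ.filter fun e : E.Dart => e.snd = v ∧ p e).card =
      (Finset.univ.filter fun e : E.Dart => e.fst = v ∧ p e.symm).card :=
  Finset.card_bij' (fun e _ => e.symm) (fun e _ => e.symm) (by simp) (by simp) (by simp) (by simp)

/-- If every subset of `X` has at least as many boundary edges as elements, then each vertex of
`X` can be given one more than its degree of the darts incident to it, each dart to one vertex at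
most: this is Hall's theorem, with `d + 1` copies of each vertex of `X` on one side. -/
theorem exists_dart_allocation {d : ℕ} (hreg : E.IsRegularOfDegree d) {X : Finset V}
    (hX : ∀ X' ⊆ X, X'.Nonempty → X'.card ≤ edgeBoundaryCard E X') :
    ∃ T : V → Finset E.Dart, (∀ v ∈ X, (T v).card = d + 1) ∧
      (∀ v, ∀ e ∈ T v, e.fst = v ∨ e.snd = v) ∧
      ∀ v w, ∀ e ∈ T v, e ∈ T w → v = w := by
  classical
  let t : X × Fin (d + 1) → Finset E.Dart :=
    fun x => Finset.univ.filter fun e => e.fst = x.1.1 ∨ e.snd = x.1.1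
  have hall : ∀ s : Finset (X × Fin (d + 1)), s.card ≤ (s.biUnion t).card := by
    intro s
    rcases s.eq_empty_or_nonempty with rfl | hs
    · simp
    let X' : Finset V := s.image fun x => x.1.1
    have hX'X : X' ⊆ X := by
      intro v hv
      obtain ⟨x, -, rfl⟩ := Finset.mem_image.1 hv
      exact x.1.2
    have h1 : s.card ≤ (d + 1) * X'.card := by
      have : (s.image fun x => (x.1.1, x.2)).card = s.card :=
        Finset.card_image_of_injective _ (fun a b h => by
          simp only [Prod.mk.injEq] at h
          exact Prod.ext (Subtype.ext h.1) h.2)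
      rw [← this]
      refine (Finset.card_le_card (t := X' ×ˢ (Finset.univ : Finset (Fin (d + 1)))) ?_).trans ?_
      · intro y hy
        obtain ⟨x, hx, rfl⟩ := Finset.mem_image.1 hy
        simp only [Finset.mem_product, Finset.mem_univ, and_true]
        exact Finset.mem_image_of_mem _ hx
      · rw [Finset.card_product, Finset.card_univ, Fintype.card_fin, mul_comm]
    have h2 : (s.biUnion t) = (Finset.univ.filter fun e : E.Dart => e.fst ∈ X') ∪
        (Finset.univ.filter fun e : E.Dart => e.fst ∉ X' ∧ e.snd ∈ X') := by
      ext e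
      simp only [Finset.mem_biUnion, t, Finset.mem_filter, Finset.mem_univ, true_and,
        Finset.mem_union, X', Finset.mem_image]
      constructor
      · rintro ⟨x, hx, h | h⟩
        · exact Or.inl ⟨x, hx, h.symm⟩
        · by_cases h' : ∃ a ∈ s, (a.1 : V) = e.fst
          · exact Or.inl h'
          · exact Or.inr ⟨h', x, hx, h.symm⟩
      · rintro (⟨x, hx, h⟩ | ⟨-, x, hx, h⟩)
        · exact ⟨x, hx, Or.inl h.symm⟩
        · exact ⟨x, hx, Or.inr h.symm⟩
    have h3 : (Finset.univ.filter fun e : E.Dart => e.fst ∈ X').card = d * X'.card := by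
      rw [Finset.card_eq_sum_card_fiberwise (f := fun e : E.Dart => e.fst) (t := X')
        (by intro e he; simpa using he)]
      rw [Finset.sum_congr rfl (g := fun _ => d), Finset.sum_const, smul_eq_mul, mul_comm]
      intro v hv
      rw [← card_darts_fst_eq_degree hreg v, Finset.filter_filter]
      congr 1
      ext e
      simp only [Finset.mem_filter, Finset.mem_univ, true_and, and_iff_right_iff_imp]
      rintro rfl
      exact hv
    have h4 := (hX X' hX'X (hs.image _)).trans (edgeBoundaryCard_le_card_darts X')
    rw [h2, Finset.card_union_of_disjoint, h3]
    · calc s.card ≤ (d + 1) * X'.card := h1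
        _ = d * X'.card + X'.card := by ring
        _ ≤ _ := by omega
    · rw [Finset.disjoint_filter]
      intro e _ h h'
      exact h'.1 h
  obtain ⟨g, hinj, hg⟩ := (Finset.all_card_le_biUnion_card_iff_exists_injective t).1 hall
  refine ⟨fun v => if hv : v ∈ X then Finset.univ.image fun i => g (⟨v, hv⟩, i) else ∅,
    ?_, ?_, ?_⟩
  · intro v hv
    simp only [hv, dite_true]
    rw [Finset.card_image_of_injective _ (fun i j h => by simpa using hinj h), Finset.card_univ,
      Fintype.card_fin]
  · intro v e he
    by_cases hv : v ∈ X
    · simp only [hv, dite_true, Finset.mem_image, Finset.mem_univ, true_and] at he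
      obtain ⟨i, rfl⟩ := he
      simpa [t] using hg (⟨v, hv⟩, i)
    · simp [hv] at he
  · intro v w e hev hew
    by_cases hv : v ∈ X
    · by_cases hw : w ∈ X
      · simp only [hv, hw, dite_true, Finset.mem_image, Finset.mem_univ, true_and] at hev hew
        obtain ⟨i, rfl⟩ := hev
        obtain ⟨j, hj⟩ := hew
        have := hinj hj
        simp only [Prod.mk.injEq, Subtype.mk.injEq] at this
        exact this.1.symm
      · simp [hw] at hew
    · simp [hv] at hev

/-- A partial orientation of the graph in which every vertex of `X` is entered more often than it
is left. An edge is oriented towards `v` when both of its darts are allocated to `v`. -/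
theorem exists_orientation_excess_pos {d : ℕ} (hreg : E.IsRegularOfDegree d) {X : Finset V}
    (hX : ∀ X' ⊆ X, X'.Nonempty → X'.card ≤ edgeBoundaryCard E X') :
    ∃ F : Finset E.Dart, (∀ e ∈ F, e.symm ∉ F) ∧
      ∀ v ∈ X, (F.filter fun e => e.fst = v).card + 1 ≤ (F.filter fun e => e.snd = v).card := by
  classical
  obtain ⟨T, hcard, hinc, hdisj⟩ := exists_dart_allocation hreg hX
  refine ⟨Finset.univ.filter fun e => e ∈ T e.snd ∧ e.symm ∈ T e.snd, ?_, ?_⟩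
  · intro e he he'
    simp only [Finset.mem_filter, Finset.mem_univ, true_and] at he he'
    exact e.fst_ne_snd (hdisj _ _ _ he'.1 he.2)
  · intro v hv
    have hD := card_darts_fst_eq_degree hreg v
    set D := Finset.univ.filter fun e : E.Dart => e.fst = v with hDdef
    set A := D.filter fun e => e ∈ T v
    set B := D.filter fun e => e.symm ∈ T v
    have hAB : A.card + B.card = d + 1 := by
      rw [← hcard v hv, ← Finset.card_filter_add_card_filter_not (s := T v) (fun e => e.fst = v)]
      congr 1
      · congr 1
        ext e
        simp only [A, D, Finset.mem_filter, Finset.mem_univ, true_and]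
        tauto
      · refine Finset.card_bij' (fun e _ => e.symm) (fun e _ => e.symm) ?_ ?_ (by simp) (by simp)
        · intro e he
          simp only [B, D, Finset.mem_filter, Finset.mem_univ, true_and] at he ⊢
          refine ⟨he.2, ?_⟩
          rw [← he.1]
          exact e.snd_ne_fst
        · intro e he
          simp only [B, D, Finset.mem_filter, Finset.mem_univ, true_and,
            SimpleGraph.Dart.symm_symm] at he ⊢
          exact ⟨(hinc v e he.1).resolve_left he.2, he.1⟩
    have hin : (A ∩ B).card = ((Finset.univ.filter fun e : E.Dart =>
        e ∈ T e.snd ∧ e.symm ∈ T e.snd).filter fun e => e.snd = v).card := by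
      refine Finset.card_bij' (fun e _ => e.symm) (fun e _ => e.symm) ?_ ?_ (by simp) (by simp)
      · intro e he
        simp only [A, B, D, Finset.mem_inter, Finset.mem_filter, Finset.mem_univ, true_and] at he ⊢
        obtain ⟨⟨rfl, h1⟩, -, h2⟩ := he
        exact ⟨⟨h2, by simpa using h1⟩, rfl⟩
      · intro e he
        simp only [A, B, D, Finset.mem_inter, Finset.mem_filter, Finset.mem_univ, true_and] at he ⊢
        obtain ⟨⟨h1, h2⟩, rfl⟩ := he
        exact ⟨⟨rfl, h2⟩, rfl, by simpa using h1⟩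
    have hout : ((Finset.univ.filter fun e : E.Dart =>
        e ∈ T e.snd ∧ e.symm ∈ T e.snd).filter fun e => e.fst = v) ⊆ D \ (A ∪ B) := by
      intro e he
      simp only [A, B, D, Finset.mem_sdiff, Finset.mem_union, Finset.mem_filter, Finset.mem_univ,
        true_and] at he ⊢
      obtain ⟨⟨h1, h2⟩, rfl⟩ := he
      refine ⟨rfl, ?_⟩
      rintro (⟨-, h⟩ | ⟨-, h⟩)
      · exact e.fst_ne_snd (hdisj _ _ _ h h1)
      · exact e.fst_ne_snd (hdisj _ _ _ h h2)
    have h1 := Finset.card_le_card hout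
    have hsub : A ∪ B ⊆ D := Finset.union_subset (Finset.filter_subset _ _)
      (Finset.filter_subset _ _)
    rw [Finset.card_sdiff_of_subset hsub] at h1
    have h2 := Finset.card_union_add_card_inter A B
    have h3 := Finset.card_le_card hsub
    omega

/-- Deleting superfluous darts from a partial orientation makes every vertex of `X` entered
exactly once more than it is left, and every dart end in `X`. -/
theorem exists_orientation_excess_one {d : ℕ} (hreg : E.IsRegularOfDegree d) {X : Finset V}
    (hX : ∀ X' ⊆ X, X'.Nonempty → X'.card ≤ edgeBoundaryCard E X') :
    ∃ F : Finset E.Dart, (∀ e ∈ F, e.symm ∉ F) ∧ (∀ e ∈ F, e.snd ∈ X) ∧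
      ∀ v ∈ X, (F.filter fun e => e.fst = v).card + 1 = (F.filter fun e => e.snd = v).card := by
  classical
  obtain ⟨F₀, h₀⟩ := exists_orientation_excess_pos hreg hX
  induction hn : F₀.card using Nat.strong_induction_on generalizing F₀ with
  | _ n ih =>
    by_cases hbad : ∃ e ∈ F₀, e.snd ∈ X →
        (F₀.filter fun e' => e'.fst = e.snd).card + 1 < (F₀.filter fun e' => e'.snd = e.snd).card
    · obtain ⟨e, he, hlt⟩ := hbad
      refine ih _ ?_ (F₀.erase e) ⟨?_, ?_⟩ rfl
      · rw [← hn]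
        exact Finset.card_erase_lt_of_mem he
      · intro a ha ha'
        exact h₀.1 a (Finset.mem_of_mem_erase ha) (Finset.mem_of_mem_erase ha')
      · intro v hv
        have hle : ((F₀.erase e).filter fun e' => e'.fst = v).card ≤
            (F₀.filter fun e' => e'.fst = v).card :=
          Finset.card_le_card (Finset.filter_subset_filter _ (Finset.erase_subset _ _))
        by_cases hev : e.snd = v
        · subst hev
          rw [Finset.filter_erase (fun e' : E.Dart => e'.snd = e.snd),
            Finset.card_erase_of_mem (by simp [he])]
          have := hlt hv
          omega
        · rw [Finset.filter_erase (fun e' : E.Dart => e'.snd = v),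
            Finset.erase_eq_of_notMem (s := F₀.filter fun e' => e'.snd = v) (by simp [hev])]
          exact (Nat.add_le_add_right hle 1).trans (h₀.2 v hv)
    · push Not at hbad
      refine ⟨F₀, h₀.1, fun e he => (hbad e he).1, fun v hv => ?_⟩
      refine le_antisymm (h₀.2 v hv) ?_
      by_cases hF : (F₀.filter fun e => e.snd = v).Nonempty
      · obtain ⟨e, he⟩ := hF
        obtain ⟨he', rfl⟩ := Finset.mem_filter.1 he
        exact (hbad e he').2
      · rw [Finset.not_nonempty_iff_eq_empty.1 hF]
        simp

variable (E) in
/-- A routing relative to a set `X` of vertices: a set `flow` of darts ending in `X`, a dart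
`root v` leaving each vertex `v`, which is not in `flow` if `v ∈ X`, and mutually inverse bijections
`next` and `prev` between `flow` and the set of the darts that start in `X` and are in `flow` or are
roots. A dart in `flow` and its successor are consecutive. Thus `flow` splits into closed trails and
trails that lead from outside `X` to the vertices of `X`, each of these being the end of one trail,
which is prolonged by the root. -/
structure Routing (X : Finset V) where
  /-- The darts of the trails, without the roots. -/
  flow : Finset E.Dart
  /-- A dart leaving the given vertex. -/
  root : V → E.Dart
  /-- The dart that follows a dart in `flow`; arbitrary on other darts. -/
  next : E.Dart → E.Dart
  /-- The dart that precedes a dart; arbitrary unless the dart starts in `X` and is in `flow` or is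
  a root. -/
  prev : E.Dart → E.Dart
  root_fst : ∀ v, (root v).fst = v
  root_notMem : ∀ v ∈ X, root v ∉ flow
  snd_mem : ∀ e ∈ flow, e.snd ∈ X
  next_fst : ∀ e ∈ flow, (next e).fst = e.snd
  next_mem : ∀ e ∈ flow, next e ∈ flow ∨ next e = root e.snd
  prev_next : ∀ e ∈ flow, prev (next e) = e
  prev_mem : ∀ e, e.fst ∈ X → e ∈ flow ∨ e = root e.fst → prev e ∈ flow
  prev_snd : ∀ e, e.fst ∈ X → e ∈ flow ∨ e = root e.fst → (prev e).snd = e.fst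
  next_prev : ∀ e, e.fst ∈ X → e ∈ flow ∨ e = root e.fst → next (prev e) = e

/-- A routing exists if `X` and its subsets have large boundaries. The darts that enter a vertex of
`X` are matched with those that leave it and the reverse of one of them, which is the root. -/
theorem exists_routing {d : ℕ} (hd : 0 < d) (hreg : E.IsRegularOfDegree d) {X : Finset V}
    (hX : ∀ X' ⊆ X, X'.Nonempty → X'.card ≤ edgeBoundaryCard E X') :
    Nonempty (Routing E X) := by
  classical
  obtain ⟨F, hanti, hF, hbal⟩ := exists_orientation_excess_one hreg hX
  have hroot : ∀ v, ∃ e : E.Dart, e.fst = v ∧ (v ∈ X → e ∉ F) := by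
    intro v
    by_cases hv : v ∈ X
    · have h1 : 0 < (F.filter fun e => e.snd = v).card := by rw [← hbal v hv]; omega
      obtain ⟨e, he⟩ := Finset.card_pos.1 h1
      obtain ⟨he', rfl⟩ := Finset.mem_filter.1 he
      exact ⟨e.symm, rfl, fun _ => hanti e he'⟩
    · rw [← card_darts_fst_eq_degree hreg v] at hd
      obtain ⟨e, he⟩ := Finset.card_pos.1 hd
      exact ⟨e, (Finset.mem_filter.1 he).2, fun h => absurd h hv⟩
  choose r hr hrF using hroot
  have hperm : ∀ v, ∃ π : Equiv.Perm E.Dart, v ∈ X → ∀ e,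
      (e ∈ F ∧ e.snd = v) ↔ (π e = r v ∨ π e ∈ F ∧ (π e).fst = v) := by
    intro v
    by_cases hv : v ∈ X
    · have hcard : (F.filter fun e => e.snd = v).card =
          (insert (r v) (F.filter fun e => e.fst = v)).card := by
        rw [Finset.card_insert_of_notMem (by simp [hrF v hv]), hbal v hv]
      refine ⟨(Finset.equivOfCardEq hcard).extendSubtype, fun _ e => ?_⟩
      constructor
      · intro h
        have := (Finset.equivOfCardEq hcard).extendSubtype_mem e (by simpa using h)
        simpa using this
      · intro h
        by_contra h'
        have := (Finset.equivOfCardEq hcard).extendSubtype_not_mem e (by simpa using h')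
        exact this (by simpa using h)
    · exact ⟨1, fun h => absurd h hv⟩
  choose π hπ using hperm
  have hnext : ∀ e ∈ F, π e.snd e = r e.snd ∨ π e.snd e ∈ F ∧ (π e.snd e).fst = e.snd :=
    fun e he => (hπ _ (hF e he) e).1 ⟨he, rfl⟩
  have hfst : ∀ e ∈ F, (π e.snd e).fst = e.snd := fun e he =>
    (hnext e he).elim (fun h => by rw [h, hr]) fun h => h.2
  have hprev : ∀ e : E.Dart, e.fst ∈ X → e ∈ F ∨ e = r e.fst →
      (π e.fst).symm e ∈ F ∧ ((π e.fst).symm e).snd = e.fst := by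
    intro e he h
    rw [hπ _ he, Equiv.apply_symm_apply]
    tauto
  exact ⟨{
    flow := F
    root := r
    next := fun e => π e.snd e
    prev := fun e => (π e.fst).symm e
    root_fst := hr
    root_notMem := hrF
    snd_mem := hF
    next_fst := hfst
    next_mem := fun e he => (hnext e he).symm.imp_left And.left
    prev_next := fun e he => by rw [hfst e he, Equiv.symm_apply_apply]
    prev_mem := fun e he h => (hprev e he h).1
    prev_snd := fun e he h => (hprev e he h).2
    next_prev := fun e he h => by rw [(hprev e he h).2, Equiv.apply_symm_apply] }⟩

end Flow

/-! ### The augmented graph -/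

section Augmented

variable {V : Type u} {E : SimpleGraph V} {X : Finset V}

theorem aVertex_ne_aVertex (e e' : E.Dart) {m n : ℕ} (hm : 1 ≤ m) (hm' : m ≤ 31) (hn : 1 ≤ n)
    (hn' : n ≤ 31) (hmn : m ≠ n) : aVertex E e m ≠ aVertex E e' n := by
  intro h
  have h' := congrArg Fin.val (Prod.mk.inj (Sum.inl.inj h)).2
  simp only [Fin.ofNat] at h'
  omega

theorem bVertex_ne_bVertex (v w : V) {m n : ℕ} (hm : 1 ≤ m) (hm' : m ≤ 6) (hn : 1 ≤ n)
    (hn' : n ≤ 6) (hmn : m ≠ n) : bVertex E v m ≠ bVertex E w n := by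
  intro h
  have h' := congrArg Fin.val (Prod.mk.inj (Sum.inr.inj h)).2
  simp only [Fin.ofNat] at h'
  omega

theorem aVertex_ne_bVertex (e : E.Dart) (v : V) (m n : ℕ) : aVertex E e m ≠ bVertex E v n :=
  Sum.inl_ne_inr

theorem aVertex_val (e : E.Dart) (i : Fin 31) : aVertex E e (i.val + 1) = Sum.inl (e, i) := by
  simp [aVertex]

theorem bVertex_val (v : V) (i : Fin 6) : bVertex E v (i.val + 1) = Sum.inr (v, i) := by
  simp [bVertex]

/-- The edges added to the gadget graph: a chord in the gadget of each dart that starts outside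
`X`, and three edges by which, for `v ∉ X`, the vertices `b_1^v, …, b_6^v` can be inserted between
the fifth and the sixth vertex of the gadget of `root v`. -/
def Routing.addedEdges (R : Routing E X) : Set (Sym2 (GadgetVertex E)) :=
  {x | ∃ e : E.Dart, e.fst ∉ X ∧ x = s(aVertex E e 17, aVertex E e 20)} ∪
  {x | ∃ v ∉ X, x ∈ ({s(bVertex E v 3, bVertex E v 5), s(bVertex E v 4, bVertex E v 6),
    s(bVertex E v 6, aVertex E (R.root v) 6)} : Set (Sym2 (GadgetVertex E)))}

/-! ### Tours of the gadgets -/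

/-- The positions that the part of the Hamiltonian cycle belonging to a dart `e` can visit: in the
gadgets of `e`, of its predecessor and of its successor in the routing, and among the vertices
`b_1, …, b_6` of the vertex where `e` starts. Positions are numbered from one. -/
inductive Slot
  | own (n : ℕ)
  | before (n : ℕ)
  | after (n : ℕ)
  | hub (n : ℕ)
  deriving DecidableEq

namespace Slot

/-- The edges of the path gadget, in one direction. -/
def pathStep (m n : ℕ) : Bool :=
  (decide (1 ≤ m) && decide (m ≤ 30) && n == m + 1) ||
  ((m == 2 || m == 27) && n == m + 3) ||
  ((m == 6 || m == 12 || m == 15 || m == 21) && n == m + 5)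

/-- Steps along edges that are in the gadget graph for every dart. -/
def baseStep : Slot → Slot → Bool
  | own m, own n => pathStep m n || pathStep n m
  | before m, before n => pathStep m n || pathStep n m
  | after m, after n => pathStep m n || pathStep n m
  | own m, hub n => m == 5 && n == 1
  | hub m, own n => m == 6 && n == 12
  | hub m, hub n => (m == 1 && n == 2) || (m == 2 && n == 3) || (m == 4 && n == 5) ||
      (m == 5 && n == 4) || (m == 5 && n == 6)
  | _, _ => false

/-- Steps along edges of the link from the predecessor. -/
def beforeStep : Slot → Slot → Bool
  | own m, before n => m == 3 && n == 23
  | before m, own n => m == 24 && n == 14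
  | hub m, before n => m == 3 && n == 23
  | before m, hub n => m == 24 && n == 4
  | _, _ => false

/-- Steps along edges of the link to the successor. -/
def afterStep : Slot → Slot → Bool
  | own m, after n => m == 18 && n == 8
  | after m, own n => m == 9 && n == 29
  | _, _ => false

/-- Steps along edges added for every dart that starts outside `X`. -/
def addedStep : Slot → Slot → Bool
  | own m, own n => m == 17 && n == 20
  | hub m, hub n => (m == 3 && n == 5) || (m == 4 && n == 6)
  | _, _ => false

/-- Steps along edges added for roots that start outside `X`. -/
def rootStep : Slot → Slot → Bool
  | hub m, own n => m == 6 && n == 6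
  | _, _ => false

/-- The steps that are allowed if the parameters say whether the dart has a predecessor, whether it
has a successor, whether it starts outside `X`, and whether moreover it is a root. -/
def step (b a x r : Bool) (s t : Slot) : Bool :=
  baseStep s t || (b && beforeStep s t) || (a && afterStep s t) || (x && addedStep s t) ||
    (r && rootStep s t)

/-- The part of the tour in which a dart in the flow visits the gadget of its successor, and its
own last vertices. -/
def visitAfter : List Slot :=
  [own 18, after 8, after 7, after 6, after 11, after 10, after 9, own 29, own 28, own 27, own 30,
    own 31]

/-- The part of the tour in which a dart visits the gadget of its predecessor. -/
def visitBefore : List Slot :=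
  [before 23, before 22, before 21, before 26, before 25, before 24]

/-- The first five vertices of a gadget. -/
def start : List Slot := [own 1, own 2, own 3, own 4, own 5]

/-- The added detour through `b_1, …, b_6`. -/
def detour : List Slot := [hub 1, hub 2, hub 3, hub 5, hub 4, hub 6]

/-- The sixth to the seventeenth vertex of a gadget. -/
def middle : List Slot :=
  [own 6, own 7, own 8, own 9, own 10, own 11, own 12, own 13, own 14, own 15, own 16, own 17]

/-- The last vertices of a gadget, from the eighteenth on. -/
def finish : List Slot :=
  [own 18, own 19, own 20, own 21, own 22, own 23, own 24, own 25, own 26, own 27, own 28, own 29,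
    own 30, own 31]

/-- The tour of a dart in the flow that starts in `X`. -/
def innerTour : List Slot :=
  [own 1, own 2, own 5, own 4, own 3] ++ visitBefore ++
    [own 14, own 13, own 12, own 17, own 16, own 15, own 20, own 19] ++ visitAfter

/-- The tour of a root that starts in `X`. -/
def lastTour : List Slot :=
  start ++ [hub 1, hub 2, hub 3] ++ visitBefore ++ [hub 4, hub 5, hub 6] ++
    [own 12, own 13, own 14, own 15, own 16, own 17] ++ finish

/-- The tour of a dart in the flow that starts outside `X`, with the given detour. -/
def firstTour (l : List Slot) : List Slot :=
  start ++ l ++ middle ++ [own 20, own 19] ++ visitAfter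

/-- The tour of a dart that is neither in the flow nor a root in `X`, with the given detour. -/
def idleTour (l : List Slot) : List Slot :=
  start ++ l ++ middle ++ finish

end Slot

namespace Routing

variable (R : Routing E X)

/-- The vertex at a position, relative to a dart. -/
def place (e : E.Dart) : Slot → GadgetVertex E
  | .own n => aVertex E e n
  | .before n => aVertex E (R.prev e) n
  | .after n => aVertex E (R.next e) n
  | .hub n => bVertex E e.fst n

open Classical in
/-- The positions visited by the part of the Hamiltonian cycle belonging to a dart. -/
noncomputable def tour (e : E.Dart) : List Slot :=
  if e.fst ∈ X then
    if e ∈ R.flow then Slot.innerTour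
    else if e = R.root e.fst then Slot.lastTour
    else Slot.idleTour []
  else
    if e ∈ R.flow then
      if e = R.root e.fst then Slot.firstTour Slot.detour else Slot.firstTour []
    else
      if e = R.root e.fst then Slot.idleTour Slot.detour else Slot.idleTour []

open Classical in
theorem tour_length (e : E.Dart) :
    (R.tour e).length = 31 + if e = R.root e.fst then 6 else 0 := by
  unfold tour
  split_ifs with h1 h2 h3 h3 h2 h3 h3
  · exact absurd (h3 ▸ h2) (R.root_notMem _ h1)
  all_goals rfl

theorem tour_head? (e : E.Dart) : (R.tour e).head? = some (.own 1) := by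
  unfold tour
  split_ifs <;> rfl

theorem tour_getLast? (e : E.Dart) : (R.tour e).getLast? = some (.own 31) := by
  unfold tour
  split_ifs <;> rfl

theorem own_mem_tour (e : E.Dart) (i : Fin 31)
    (h1 : e.fst ∈ X → (e ∈ R.flow ∨ e = R.root e.fst) → ¬ (6 ≤ i.val + 1 ∧ i.val + 1 ≤ 11))
    (h2 : e ∈ R.flow → ¬ (21 ≤ i.val + 1 ∧ i.val + 1 ≤ 26)) :
    Slot.own (i.val + 1) ∈ R.tour e := by
  unfold tour
  split_ifs with h3 h4 h5 h4 h5 h5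
  · have := h1 h3 (Or.inl h4)
    have := h2 h4
    clear h1 h2
    revert i
    decide
  · have := h1 h3 (Or.inr h5)
    clear h1 h2
    revert i
    decide
  · clear h1 h2
    revert i
    decide
  · have := h2 h4
    clear h1 h2
    revert i
    decide
  · have := h2 h4
    clear h1 h2
    revert i
    decide
  · clear h1 h2
    revert i
    decide
  · clear h1 h2
    revert i
    decide

theorem before_mem_tour (e : E.Dart) (h : e.fst ∈ X) (h' : e ∈ R.flow ∨ e = R.root e.fst)
    (i : Fin 31) (hi : 21 ≤ i.val + 1 ∧ i.val + 1 ≤ 26) : Slot.before (i.val + 1) ∈ R.tour e := by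
  rw [tour, if_pos h]
  split_ifs with h3 h4
  · clear h'
    revert i
    decide
  · clear h'
    revert i
    decide
  · tauto

theorem after_mem_tour (e : E.Dart) (h : e ∈ R.flow)
    (i : Fin 31) (hi : 6 ≤ i.val + 1 ∧ i.val + 1 ≤ 11) : Slot.after (i.val + 1) ∈ R.tour e := by
  unfold tour
  split_ifs <;> revert i <;> decide

theorem hub_mem_tour (v : V) (i : Fin 6) : Slot.hub (i.val + 1) ∈ R.tour (R.root v) := by
  unfold tour
  simp only [R.root_fst, if_true]
  split_ifs with h1 h2
  · exact absurd h2 (R.root_notMem v (by rwa [R.root_fst] at h1))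
  all_goals revert i; decide

theorem exists_mem_tour (x : GadgetVertex E) :
    ∃ e, x ∈ (R.tour e).map (R.place e) := by
  simp only [List.mem_map]
  rcases x with ⟨e, i⟩ | ⟨v, i⟩
  · by_cases h1 : e ∈ R.flow ∧ 21 ≤ i.val + 1 ∧ i.val + 1 ≤ 26
    · refine ⟨R.next e, .before (i.val + 1), R.before_mem_tour _ ?_ ?_ i h1.2, ?_⟩
      · rw [R.next_fst e h1.1]
        exact R.snd_mem e h1.1
      · rw [R.next_fst e h1.1]
        exact R.next_mem e h1.1
      · rw [place, R.prev_next e h1.1, aVertex_val]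
    · by_cases h2 : (e.fst ∈ X ∧ (e ∈ R.flow ∨ e = R.root e.fst)) ∧
          6 ≤ i.val + 1 ∧ i.val + 1 ≤ 11
      · refine ⟨R.prev e, .after (i.val + 1),
          R.after_mem_tour _ (R.prev_mem e h2.1.1 h2.1.2) i h2.2, ?_⟩
        rw [place, R.next_prev e h2.1.1 h2.1.2, aVertex_val]
      · refine ⟨e, .own (i.val + 1), R.own_mem_tour e i ?_ ?_, aVertex_val e i⟩
        · exact fun h h' h'' => h2 ⟨⟨h, h'⟩, h''⟩
        · exact fun h h' => h1 ⟨h, h'⟩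
  · refine ⟨R.root v, .hub (i.val + 1), R.hub_mem_tour v i, ?_⟩
    rw [place, R.root_fst, bVertex_val]

end Routing

/-! ### The Hamiltonian cycle of the augmented graph -/

variable [Fintype V] [DecidableRel E.Adj]

theorem card_gadgetVertex : Fintype.card (GadgetVertex E) =
    31 * Fintype.card E.Dart + 6 * Fintype.card V := by
  simp [GadgetVertex, mul_comm]

variable [DecidableEq V]

/-- The gadget graph with the edges `Routing.addedEdges`. -/
def Routing.augmentedGraph (R : Routing E X) (f : E.Dart ≃ Fin (Fintype.card E.Dart)) :
    SimpleGraph (GadgetVertex E) :=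
  gadgetGraph E f ⊔ SimpleGraph.fromEdgeSet R.addedEdges

theorem gadgetGraph_adj_of_link (f : E.Dart ≃ Fin (Fintype.card E.Dart)) {e e' : E.Dart}
    (h : e.snd = e'.fst) {x y : GadgetVertex E} (hxy : x ≠ y)
    (hl : s(x, y) ∈ linkEdges (aVertex E e) (aVertex E e') (bVertex E e.snd)) :
    (gadgetGraph E f).Adj x y := by
  rw [gadgetGraph, SimpleGraph.fromEdgeSet_adj]
  exact ⟨Or.inr ⟨e, e', h, hl⟩, hxy⟩

theorem gadgetGraph_adj_of_path (f : E.Dart ≃ Fin (Fintype.card E.Dart)) {e : E.Dart}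
    {x y : GadgetVertex E} (hxy : x ≠ y) (hl : s(x, y) ∈ pathGadgetEdges (aVertex E e)) :
    (gadgetGraph E f).Adj x y := by
  rw [gadgetGraph, SimpleGraph.fromEdgeSet_adj]
  exact ⟨Or.inl (Or.inl ⟨e, hl⟩), hxy⟩

theorem gadgetGraph_adj_of_cycle (f : E.Dart ≃ Fin (Fintype.card E.Dart))
    (i : Fin (Fintype.card E.Dart)) :
    (gadgetGraph E f).Adj (aVertex E (f.symm i) 31) (aVertex E (f.symm (finRotate _ i)) 1) := by
  rw [gadgetGraph, SimpleGraph.fromEdgeSet_adj]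
  exact ⟨Or.inl (Or.inr ⟨i, rfl⟩),
    aVertex_ne_aVertex _ _ (by norm_num) le_rfl le_rfl (by norm_num) (by norm_num)⟩

namespace Routing

variable (R : Routing E X)

theorem augmentedGraph_adj_of_path (f : E.Dart ≃ Fin (Fintype.card E.Dart)) (e : E.Dart)
    {m n : ℕ} (h : Slot.pathStep m n) :
    (R.augmentedGraph f).Adj (aVertex E e m) (aVertex E e n) := by
  simp only [Slot.pathStep, Bool.or_eq_true, Bool.and_eq_true, decide_eq_true_eq, beq_iff_eq] at h
  refine Or.inl (gadgetGraph_adj_of_path f (e := e)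
    (aVertex_ne_aVertex e e (by omega) (by omega) (by omega) (by omega) (by omega)) ?_)
  obtain (⟨⟨h1, h2⟩, rfl⟩ | ⟨h1, rfl⟩) | ⟨h1, rfl⟩ := h
  · exact Or.inl (Or.inl ⟨m, ⟨h1, h2⟩, rfl⟩)
  · exact Or.inl (Or.inr ⟨m, by simpa using h1, rfl⟩)
  · exact Or.inr ⟨m, by simpa [or_assoc] using h1, rfl⟩

theorem augmentedGraph_adj_of_link (f : E.Dart ≃ Fin (Fintype.card E.Dart)) {e e' : E.Dart}
    (h : e.snd = e'.fst) {x y : GadgetVertex E} (hxy : x ≠ y)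
    (hl : s(x, y) ∈ linkEdges (aVertex E e) (aVertex E e') (bVertex E e'.fst)) :
    (R.augmentedGraph f).Adj x y :=
  Or.inl (gadgetGraph_adj_of_link f h hxy (by rwa [h]))

theorem augmentedGraph_adj_of_added (f : E.Dart ≃ Fin (Fintype.card E.Dart))
    {x y : GadgetVertex E} (hxy : x ≠ y) (hl : s(x, y) ∈ R.addedEdges) :
    (R.augmentedGraph f).Adj x y :=
  Or.inr ((SimpleGraph.fromEdgeSet_adj _).2 ⟨hl, hxy⟩)

theorem augmentedGraph_adj_of_step (f : E.Dart ≃ Fin (Fintype.card E.Dart)) (e : E.Dart)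
    {b a x r : Bool} (hb : b → (R.prev e).snd = e.fst) (ha : a → (R.next e).fst = e.snd)
    (hx : x → e.fst ∉ X) (hr : r → e.fst ∉ X ∧ e = R.root e.fst) {s t : Slot}
    (h : Slot.step b a x r s t) : (R.augmentedGraph f).Adj (R.place e s) (R.place e t) := by
  simp only [Slot.step, Bool.or_eq_true, Bool.and_eq_true] at h
  obtain (((h | ⟨h1, h⟩) | ⟨h1, h⟩) | ⟨h1, h⟩) | ⟨h1, h⟩ := h
  · -- an edge at a vertex `b_i^v` is in every link at `v`, so in that from the reverse of `e`
    have hl := fun {x y : GadgetVertex E} => R.augmentedGraph_adj_of_link f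
      (e := e.symm) (e' := e) rfl (x := x) (y := y)
    cases s <;> cases t <;>
      simp only [Slot.baseStep, Bool.or_eq_true, Bool.and_eq_true, beq_iff_eq,
        Bool.false_eq_true] at h
    · exact h.elim (R.augmentedGraph_adj_of_path f _) fun h =>
        (R.augmentedGraph_adj_of_path f _ h).symm
    · obtain ⟨rfl, rfl⟩ := h
      exact hl (aVertex_ne_bVertex _ _ _ _) (by simp [linkEdges, place])
    · exact h.elim (R.augmentedGraph_adj_of_path f _) fun h =>
        (R.augmentedGraph_adj_of_path f _ h).symm
    · exact h.elim (R.augmentedGraph_adj_of_path f _) fun h =>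
        (R.augmentedGraph_adj_of_path f _ h).symm
    · obtain ⟨rfl, rfl⟩ := h
      exact hl (aVertex_ne_bVertex _ _ _ _).symm (by simp [linkEdges, place])
    · obtain (((⟨rfl, rfl⟩ | ⟨rfl, rfl⟩) | ⟨rfl, rfl⟩) | ⟨rfl, rfl⟩) | ⟨rfl, rfl⟩ := h <;>
        exact hl (bVertex_ne_bVertex _ _ (by norm_num) (by norm_num) (by norm_num) (by norm_num)
          (by norm_num)) (by simp [linkEdges, place])
  · have hl := fun {x y : GadgetVertex E} => R.augmentedGraph_adj_of_link f (hb h1)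
      (x := x) (y := y)
    cases s <;> cases t <;>
      simp only [Slot.beforeStep, Bool.and_eq_true, beq_iff_eq, Bool.false_eq_true] at h
    · obtain ⟨rfl, rfl⟩ := h
      exact hl (aVertex_ne_aVertex _ _ (by norm_num) (by norm_num) (by norm_num) (by norm_num)
        (by norm_num)) (by simp [linkEdges, place])
    · obtain ⟨rfl, rfl⟩ := h
      exact hl (aVertex_ne_aVertex _ _ (by norm_num) (by norm_num) (by norm_num) (by norm_num)
        (by norm_num)) (by simp [linkEdges, place])
    · obtain ⟨rfl, rfl⟩ := h
      exact hl (aVertex_ne_bVertex _ _ _ _) (by simp [linkEdges, place])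
    · obtain ⟨rfl, rfl⟩ := h
      exact hl (aVertex_ne_bVertex _ _ _ _).symm (by simp [linkEdges, place])
  · have hl := fun {x y : GadgetVertex E} => R.augmentedGraph_adj_of_link f (ha h1).symm
      (x := x) (y := y)
    cases s <;> cases t <;>
      simp only [Slot.afterStep, Bool.and_eq_true, beq_iff_eq, Bool.false_eq_true] at h <;>
      obtain ⟨rfl, rfl⟩ := h <;>
      exact hl (aVertex_ne_aVertex _ _ (by norm_num) (by norm_num) (by norm_num) (by norm_num)
        (by norm_num)) (by simp [linkEdges, place])
  · cases s <;> cases t <;>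
      simp only [Slot.addedStep, Bool.or_eq_true, Bool.and_eq_true, beq_iff_eq,
        Bool.false_eq_true] at h
    · obtain ⟨rfl, rfl⟩ := h
      exact R.augmentedGraph_adj_of_added f (aVertex_ne_aVertex _ _ (by norm_num) (by norm_num)
        (by norm_num) (by norm_num) (by norm_num)) (Or.inl ⟨e, hx h1, rfl⟩)
    · obtain ⟨rfl, rfl⟩ | ⟨rfl, rfl⟩ := h <;>
        exact R.augmentedGraph_adj_of_added f (bVertex_ne_bVertex _ _ (by norm_num) (by norm_num)
          (by norm_num) (by norm_num) (by norm_num)) (Or.inr ⟨e.fst, hx h1, by simp [place]⟩)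
  · cases s <;> cases t <;>
      simp only [Slot.rootStep, Bool.and_eq_true, beq_iff_eq, Bool.false_eq_true] at h
    obtain ⟨rfl, rfl⟩ := h
    refine R.augmentedGraph_adj_of_added f (aVertex_ne_bVertex _ _ _ _).symm
      (Or.inr ⟨e.fst, (hr h1).1, ?_⟩)
    rw [← (hr h1).2]
    simp [place]

theorem tour_isChain (f : E.Dart ≃ Fin (Fintype.card E.Dart)) (e : E.Dart) :
    ((R.tour e).map (R.place e)).IsChain (R.augmentedGraph f).Adj := by
  have key : ∀ (b a x r : Bool), (b → (R.prev e).snd = e.fst) → (a → (R.next e).fst = e.snd) →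
      (x → e.fst ∉ X) → (r → e.fst ∉ X ∧ e = R.root e.fst) → ∀ l : List Slot,
      l.IsChain (fun s t => Slot.step b a x r s t) →
      (l.map (R.place e)).IsChain (R.augmentedGraph f).Adj := fun b a x r hb ha hx hr l hl =>
    List.isChain_map_of_isChain _ (fun s t h => R.augmentedGraph_adj_of_step f e hb ha hx hr h) hl
  unfold tour
  split_ifs with h1 h2 h3 h2 h3 h3
  · exact key true true false false (fun _ => R.prev_snd e h1 (Or.inl h2))
      (fun _ => R.next_fst e h2) (by simp) (by simp) _ (by decide)
  · exact key true false false false (fun _ => R.prev_snd e h1 (Or.inr h3))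
      (by simp) (by simp) (by simp) _ (by decide)
  · exact key false false false false (by simp) (by simp) (by simp) (by simp) _ (by decide)
  · exact key false true true true (by simp) (fun _ => R.next_fst e h2) (fun _ => h1)
      (fun _ => ⟨h1, h3⟩) _ (by decide)
  · exact key false true true false (by simp) (fun _ => R.next_fst e h2) (fun _ => h1)
      (by simp) _ (by decide)
  · exact key false false true true (by simp) (by simp) (fun _ => h1) (fun _ => ⟨h1, h3⟩) _
      (by decide)
  · exact key false false false false (by simp) (by simp) (by simp) (by simp) _ (by decide)

/-- The tours of the gadgets, joined in the cyclic order of the darts, form a Hamiltonian cycle: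
they cover all vertices, and their total length is the number of vertices. -/
theorem augmentedGraph_isHamiltonian [Nonempty V] (f : E.Dart ≃ Fin (Fintype.card E.Dart))
    [DecidableEq (GadgetVertex E)] : (R.augmentedGraph f).IsHamiltonian := by
  classical
  let T : Fin (Fintype.card E.Dart) → List (GadgetVertex E) :=
    fun i => (R.tour (f.symm i)).map (R.place (f.symm i))
  have hhead : ∀ i, (T i).head? = some (aVertex E (f.symm i) 1) := fun i => by
    simp only [T, List.head?_map, R.tour_head?, Option.map_some]
    rfl
  have hlast : ∀ i, (T i).getLast? = some (aVertex E (f.symm i) 31) := fun i => by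
    simp only [T, List.getLast?_map, R.tour_getLast?, Option.map_some]
    rfl
  have hchain := List.isChain_flatten_ofFn_finRotate (T := T) (r := (R.augmentedGraph f).Adj)
    (fun i h => by simpa [h] using hhead i) (fun i => R.tour_isChain f _) (by
      intro i x hx y hy
      rw [hlast, Option.mem_some_iff] at hx
      rw [hhead, Option.mem_some_iff] at hy
      subst hx hy
      exact Or.inl (gadgetGraph_adj_of_cycle f i))
  refine SimpleGraph.isHamiltonian_of_isChain (l := (List.ofFn T).flatten) hchain.1 hchain.2 ?_ ?_ ?_
  · intro x
    obtain ⟨e, he⟩ := R.exists_mem_tour x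
    rw [List.mem_flatten]
    exact ⟨_, List.mem_ofFn.2 ⟨f e, rfl⟩, by simpa [T] using he⟩
  · apply le_of_eq
    have h1 : (List.ofFn T).flatten.length = ∑ e : E.Dart, (R.tour e).length := by
      rw [List.length_flatten, List.map_ofFn, List.sum_ofFn]
      rw [← Equiv.sum_comp f.symm]
      simp [T]
    have h2 : (Finset.univ.filter fun e : E.Dart => e = R.root e.fst).card = Fintype.card V := by
      rw [← Finset.card_univ (α := V)]
      refine Finset.card_bij' (fun e _ => e.fst) (fun v _ => R.root v) (by simp) ?_ ?_ ?_
      · simp [R.root_fst]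
      · intro e he
        exact (Finset.mem_filter.1 he).2.symm
      · simp [R.root_fst]
    rw [h1, card_gadgetVertex, ← h2]
    simp only [R.tour_length, Finset.sum_add_distrib, Finset.sum_const, Finset.card_univ,
      smul_eq_mul, Finset.card_filter, Finset.mul_sum, mul_comm 31]
    congr 1
    refine Finset.sum_congr rfl fun e _ => ?_
    split_ifs <;> rfl
  · have hpos : 0 < Fintype.card E.Dart :=
      Fintype.card_pos_iff.2 ⟨R.root (Classical.arbitrary V)⟩
    rw [card_gadgetVertex]
    omega

end Routing

end Augmented

/-! ### Neighbourhoods in the augmented graph -/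

section Neighbourhoods

variable {V : Type u} {E : SimpleGraph V} {X : Finset V}

/-- Positions of adjacent vertices in the gadget of one dart, in the augmented graph. -/
def ownAdj (m n : ℕ) : Bool :=
  Slot.pathStep m n || Slot.pathStep n m || (m == 17 && n == 20) || (m == 20 && n == 17)

/-- Positions of adjacent vertices in the gadgets of two consecutive darts. -/
def linkAdj (m n : ℕ) : Bool :=
  (m == 23 && n == 3) || (m == 18 && n == 8) || (m == 29 && n == 9) || (m == 24 && n == 14)

/-- Positions `m` and `n` such that `a_m^e` is adjacent to `b_n^v` for the darts `e` ending
at `v`. -/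
def hubInAdj (m n : ℕ) : Bool := (m == 23 && n == 3) || (m == 24 && n == 4)

/-- Positions `m` and `n` such that `a_m^e` is adjacent to `b_n^v` for the darts `e` starting
at `v`. -/
def hubOutAdj (m n : ℕ) : Bool := (m == 5 && n == 1) || (m == 12 && n == 6)

/-- Positions `m` and `n` such that `a_m^e` is adjacent to `b_n^v` for the root `e` of `v`. -/
def rootAdj (m n : ℕ) : Bool := m == 6 && n == 6

/-- Positions of adjacent vertices among `b_1^v, …, b_6^v`, in the augmented graph, in one
direction. -/
def hubStep (m n : ℕ) : Bool :=
  (m == 1 && n == 2) || (m == 2 && n == 3) || (m == 4 && n == 5) || (m == 5 && n == 6) ||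
    (m == 3 && n == 5) || (m == 4 && n == 6)

/-- The vertex of `E` to which a vertex of the gadget graph belongs: `b_i^v` belongs to `v`, and
`a_i^e` to the vertex where `e` starts. -/
def baseVertex : GadgetVertex E → V
  | Sum.inl (e, _) => e.fst
  | Sum.inr (v, _) => v

variable [Fintype V] [DecidableEq V] [DecidableRel E.Adj]

/-- A finite set that contains the neighbours of a vertex in the augmented graph. The ends of the
added edges are included whether or not the darts and vertices concerned avoid `X`. -/
def Routing.nearby (R : Routing E X) (f : E.Dart ≃ Fin (Fintype.card E.Dart)) :
    GadgetVertex E → Finset (GadgetVertex E)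
  | Sum.inl (e, i) =>
    (Finset.univ.filter fun j : Fin 31 => ownAdj (i + 1) (j + 1)).image (fun j => Sum.inl (e, j)) ∪
    (Finset.univ.filter fun j : Fin 31 => i = 30 ∧ j = 0).image
      (fun j => Sum.inl (f.symm (finRotate _ (f e)), j)) ∪
    (Finset.univ.filter fun j : Fin 31 => i = 0 ∧ j = 30).image
      (fun j => Sum.inl (f.symm ((finRotate _).symm (f e)), j)) ∪
    ((Finset.univ.filter fun e' : E.Dart => e'.fst = e.snd) ×ˢ
      Finset.univ.filter fun j : Fin 31 => linkAdj (i + 1) (j + 1)).image Sum.inl ∪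
    ((Finset.univ.filter fun e' : E.Dart => e'.snd = e.fst) ×ˢ
      Finset.univ.filter fun j : Fin 31 => linkAdj (j + 1) (i + 1)).image Sum.inl ∪
    (Finset.univ.filter fun j : Fin 6 => hubInAdj (i + 1) (j + 1)).image
      (fun j => Sum.inr (e.snd, j)) ∪
    (Finset.univ.filter fun j : Fin 6 => hubOutAdj (i + 1) (j + 1) || rootAdj (i + 1) (j + 1)).image
      (fun j => Sum.inr (e.fst, j))
  | Sum.inr (v, i) =>
    (Finset.univ.filter fun j : Fin 6 => hubStep (i + 1) (j + 1) || hubStep (j + 1) (i + 1)).image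
      (fun j => Sum.inr (v, j)) ∪
    ((Finset.univ.filter fun e : E.Dart => e.snd = v) ×ˢ
      Finset.univ.filter fun j : Fin 31 => hubInAdj (j + 1) (i + 1)).image Sum.inl ∪
    ((Finset.univ.filter fun e : E.Dart => e.fst = v) ×ˢ
      Finset.univ.filter fun j : Fin 31 => hubOutAdj (j + 1) (i + 1)).image Sum.inl ∪
    (Finset.univ.filter fun j : Fin 31 => rootAdj (j + 1) (i + 1)).image
      (fun j => Sum.inl (R.root v, j))

namespace Routing

variable (R : Routing E X) (f : E.Dart ≃ Fin (Fintype.card E.Dart))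

theorem mem_nearby_of_pathStep (e : E.Dart) {m n : ℕ} (h : Slot.pathStep m n) :
    aVertex E e n ∈ R.nearby f (aVertex E e m) ∧ aVertex E e m ∈ R.nearby f (aVertex E e n) := by
  have h' := h
  simp only [Slot.pathStep, Bool.or_eq_true, Bool.and_eq_true, decide_eq_true_eq,
    beq_iff_eq] at h'
  obtain ⟨i, rfl⟩ : ∃ i : Fin 31, m = i.val + 1 := ⟨⟨m - 1, by omega⟩, by simp only; omega⟩
  obtain ⟨j, rfl⟩ : ∃ j : Fin 31, n = j.val + 1 := ⟨⟨n - 1, by omega⟩, by simp only; omega⟩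
  rw [aVertex_val, aVertex_val]
  simp [nearby, ownAdj, h]

/-- The edges of the augmented graph join vertices to vertices nearby. -/
theorem mem_nearby_of_adj {x y : GadgetVertex E} (h : (R.augmentedGraph f).Adj x y) :
    y ∈ R.nearby f x := by
  have key : ∀ p q : GadgetVertex E, s(x, y) = s(p, q) →
      q ∈ R.nearby f p ∧ p ∈ R.nearby f q → y ∈ R.nearby f x := by
    intro p q hpq h
    rcases Sym2.eq_iff.1 hpq with ⟨rfl, rfl⟩ | ⟨rfl, rfl⟩
    · exact h.1
    · exact h.2
  rw [augmentedGraph, gadgetGraph, SimpleGraph.sup_adj, SimpleGraph.fromEdgeSet_adj,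
    SimpleGraph.fromEdgeSet_adj] at h
  obtain ⟨(⟨e, h⟩ | ⟨i, h⟩) | ⟨e, e', hee', h⟩, -⟩ | ⟨⟨e, -, h⟩ | ⟨v, -, h⟩, -⟩ := h
  · obtain (⟨m, hm, h⟩ | ⟨m, hm, h⟩) | ⟨m, hm, h⟩ := h
    · exact key _ _ h (R.mem_nearby_of_pathStep f e (by
        simp [Slot.pathStep, hm.1, hm.2]))
    · exact key _ _ h (R.mem_nearby_of_pathStep f e (by
        rcases hm with rfl | rfl <;> rfl))
    · exact key _ _ h (R.mem_nearby_of_pathStep f e (by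
        rcases hm with rfl | rfl | rfl | rfl <;> rfl))
  · exact key _ _ h (by simp [nearby, aVertex, -finRotate_apply])
  · simp only [linkEdges, Set.mem_insert_iff, Set.mem_singleton_iff] at h
    rcases h with h | h | h | h | h | h | h | h | h | h | h | h <;>
      exact key _ _ h (by
        simp [nearby, aVertex, bVertex, linkAdj, hubInAdj, hubOutAdj, rootAdj, hubStep, hee'])
  · exact key _ _ h (by simp [nearby, aVertex, ownAdj])
  · simp only [Set.mem_insert_iff, Set.mem_singleton_iff] at h
    rcases h with h | h | h <;>
      exact key _ _ h (by
        simp [nearby, aVertex, bVertex, hubInAdj, hubOutAdj, rootAdj, hubStep, R.root_fst])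

theorem card_nearby_le {d : ℕ} (hd : 2 ≤ d) (hreg : E.IsRegularOfDegree d) (x : GadgetVertex E) :
    (R.nearby f x).card ≤ d + 3 := by
  have hout : ∀ v, (Finset.univ.filter fun e : E.Dart => e.fst = v).card = d :=
    card_darts_fst_eq_degree hreg
  have hin : ∀ v, (Finset.univ.filter fun e : E.Dart => e.snd = v).card = d := fun v => by
    simpa [hout] using card_darts_snd_eq_card_darts_fst (E := E) v (fun _ => True)
  -- at most one of the families of `d` neighbours is present, and at most three other neighbours
  -- if one is
  have bound : ∀ k c : ℕ, k ≤ 1 ∧ c + 2 * k ≤ 5 → c + d * k ≤ d + 3 := by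
    rintro k c ⟨hk, hc⟩
    interval_cases k <;> omega
  rcases x with ⟨e, i⟩ | ⟨v, i⟩
  · rw [nearby]
    refine le_trans ?_ (bound
      ((Finset.univ.filter fun j : Fin 31 => linkAdj (i + 1) (j + 1)).card +
        (Finset.univ.filter fun j : Fin 31 => linkAdj (j + 1) (i + 1)).card)
      ((Finset.univ.filter fun j : Fin 31 => ownAdj (i + 1) (j + 1)).card +
        (Finset.univ.filter fun j : Fin 31 => i = 30 ∧ j = 0).card +
        (Finset.univ.filter fun j : Fin 31 => i = 0 ∧ j = 30).card +
        (Finset.univ.filter fun j : Fin 6 => hubInAdj (i + 1) (j + 1)).card +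
        (Finset.univ.filter fun j : Fin 6 =>
          hubOutAdj (i + 1) (j + 1) || rootAdj (i + 1) (j + 1)).card) ?_)
    · refine (Finset.card_union_le _ _).trans ?_
      refine (Nat.add_le_add ((Finset.card_union_le _ _).trans (Nat.add_le_add
        ((Finset.card_union_le _ _).trans (Nat.add_le_add
        ((Finset.card_union_le _ _).trans (Nat.add_le_add
        ((Finset.card_union_le _ _).trans (Nat.add_le_add
        ((Finset.card_union_le _ _).trans (Nat.add_le_add
        Finset.card_image_le Finset.card_image_le)) Finset.card_image_le)) Finset.card_image_le))
        Finset.card_image_le)) Finset.card_image_le)) Finset.card_image_le).trans (le_of_eq ?_)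
      rw [Finset.card_product, Finset.card_product, hin, hout]
      ring
    · revert i
      decide
  · rw [nearby]
    refine le_trans ?_ (bound
      ((Finset.univ.filter fun j : Fin 31 => hubInAdj (j + 1) (i + 1)).card +
        (Finset.univ.filter fun j : Fin 31 => hubOutAdj (j + 1) (i + 1)).card)
      ((Finset.univ.filter fun j : Fin 6 =>
          hubStep (i + 1) (j + 1) || hubStep (j + 1) (i + 1)).card +
        (Finset.univ.filter fun j : Fin 31 => rootAdj (j + 1) (i + 1)).card) ?_)
    · refine (Finset.card_union_le _ _).trans ?_
      refine (Nat.add_le_add ((Finset.card_union_le _ _).trans (Nat.add_le_add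
        ((Finset.card_union_le _ _).trans (Nat.add_le_add
        Finset.card_image_le Finset.card_image_le)) Finset.card_image_le))
        Finset.card_image_le).trans (le_of_eq ?_)
      rw [Finset.card_product, Finset.card_product, hin, hout]
      ring
    · revert i
      decide

theorem augmentedGraph_boundedDegree {d : ℕ} (hd : 2 ≤ d) (hreg : E.IsRegularOfDegree d) :
    boundedDegree (d + 3) (GadgetVertex E) (R.augmentedGraph f) := by
  intro x
  refine le_trans ?_ (R.card_nearby_le f hd hreg x)
  rw [← Set.ncard_coe_finset]
  exact Set.ncard_le_ncard (fun y hy => R.mem_nearby_of_adj f hy) (Finset.finite_toSet _)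

/-- All neighbours of `a_17^e` belong to the same vertex of `E` as `a_17^e` itself. -/
theorem baseVertex_of_adj_aVertex {e : E.Dart} {y : GadgetVertex E}
    (h : (R.augmentedGraph f).Adj (aVertex E e 17) y) : baseVertex y = e.fst := by
  have h' : y ∈ R.nearby f (Sum.inl (e, 16)) := R.mem_nearby_of_adj f h
  have h1 : (Finset.univ.filter fun j : Fin 31 => linkAdj ((16 : Fin 31) + 1) (j + 1)) = ∅ := by
    decide
  have h2 : (Finset.univ.filter fun j : Fin 31 => linkAdj (j + 1) ((16 : Fin 31) + 1)) = ∅ := by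
    decide
  have h3 : (Finset.univ.filter fun j : Fin 6 => hubInAdj ((16 : Fin 31) + 1) (j + 1)) = ∅ := by
    decide
  rw [nearby, h1, h2, h3] at h'
  simp only [Finset.product_empty, Finset.image_empty, Finset.union_empty, Finset.mem_union,
    Finset.mem_image, Finset.mem_filter] at h'
  obtain ((⟨j, -, rfl⟩ | ⟨j, ⟨-, h, -⟩, -⟩) | ⟨j, ⟨-, h, -⟩, -⟩) | ⟨j, -, rfl⟩ := h'
  · rfl
  · exact absurd h (by decide)
  · exact absurd h (by decide)
  · rfl

/-- All neighbours of `b_5^v` and `b_6^v` belong to `v`. -/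
theorem baseVertex_of_adj_bVertex {v : V} {i : Fin 6} (hi : i = 4 ∨ i = 5) {y : GadgetVertex E}
    (h : (R.augmentedGraph f).Adj (Sum.inr (v, i)) y) : baseVertex y = v := by
  have h' := R.mem_nearby_of_adj f h
  have h1 : (Finset.univ.filter fun j : Fin 31 => hubInAdj (j + 1) (i + 1)) = ∅ := by
    rcases hi with rfl | rfl <;> decide
  rw [nearby, h1] at h'
  simp only [Finset.product_empty, Finset.image_empty, Finset.union_empty, Finset.mem_union,
    Finset.mem_image, Finset.mem_filter, Finset.mem_product] at h'
  obtain (⟨j, -, rfl⟩ | ⟨⟨e, j⟩, ⟨⟨-, hev⟩, -⟩, rfl⟩) | ⟨j, -, rfl⟩ := h'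
  · rfl
  · exact hev
  · exact R.root_fst v

/-- The ends of an added edge belong to vertices outside `X`, and the neighbours of one of them
do so, too. -/
theorem addedEdges_far {x y : GadgetVertex E} (h : s(x, y) ∈ R.addedEdges) :
    baseVertex x ∉ X ∧ baseVertex y ∉ X ∧
      ((∀ z, (R.augmentedGraph f).Adj x z → baseVertex z ∉ X) ∨
        ∀ z, (R.augmentedGraph f).Adj y z → baseVertex z ∉ X) := by
  have key : ∀ p q : GadgetVertex E, s(x, y) = s(p, q) → baseVertex p ∉ X → baseVertex q ∉ X →
      (∀ z, (R.augmentedGraph f).Adj p z → baseVertex z ∉ X) →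
      baseVertex x ∉ X ∧ baseVertex y ∉ X ∧
      ((∀ z, (R.augmentedGraph f).Adj x z → baseVertex z ∉ X) ∨
        ∀ z, (R.augmentedGraph f).Adj y z → baseVertex z ∉ X) := by
    intro p q hpq hp hq hz
    rcases Sym2.eq_iff.1 hpq with ⟨rfl, rfl⟩ | ⟨rfl, rfl⟩
    · exact ⟨hp, hq, Or.inl hz⟩
    · exact ⟨hq, hp, Or.inr hz⟩
  have hb : ∀ v ∉ X, ∀ i : Fin 6, i = 4 ∨ i = 5 → ∀ z,
      (R.augmentedGraph f).Adj (Sum.inr (v, i)) z → baseVertex z ∉ X := fun v hv i hi z hz => by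
    rwa [R.baseVertex_of_adj_bVertex f hi hz]
  obtain ⟨e, he, h⟩ | ⟨v, hv, h⟩ := h
  · exact key _ _ h he he fun z hz => by rwa [R.baseVertex_of_adj_aVertex f hz]
  · simp only [Set.mem_insert_iff, Set.mem_singleton_iff] at h
    rcases h with h | h | h
    · exact key _ _ (h.trans Sym2.eq_swap) hv hv (hb v hv 4 (Or.inl rfl))
    · exact key _ _ (h.trans Sym2.eq_swap) hv hv (hb v hv 5 (Or.inr rfl))
    · refine key _ _ h hv ?_ (hb v hv 5 (Or.inr rfl))
      change (R.root v).fst ∉ X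
      rwa [R.root_fst]

end Routing

end Neighbourhoods

/-! ### Local Hamiltonicity -/

theorem card_le_edgeBoundaryCard {V : Type u} [Fintype V] {E : SimpleGraph V}
    (hexp : 1 ≤ expansionRatio E) {X : Finset V} (hX : X.Nonempty)
    (hcard : 2 * X.card ≤ Fintype.card V) : X.card ≤ edgeBoundaryCard E X := by
  have h := hexp.trans (ciInf_le (Set.finite_range _).bddBelow
    (⟨X, hX, hcard⟩ : {S : Finset V // S.Nonempty ∧ 2 * S.card ≤ Fintype.card V}))
  rw [le_div_iff₀ (by exact_mod_cast hX.card_pos), one_mul] at h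
  exact_mod_cast h

/-- A supergraph whose new edges avoid `S` and do not lie in the closed neighbourhood of `S` has
the same closed neighbourhood of `S`, with the same induced subgraph. -/
theorem closedNbhd_and_induce_eq {W : Type*} {G H : SimpleGraph W} (hGH : G ≤ H) {S : Set W}
    (h : ∀ x y, H.Adj x y → ¬ G.Adj x y →
      x ∉ S ∧ ¬ (x ∈ closedNbhd G S ∧ y ∈ closedNbhd G S)) :
    closedNbhd H S = closedNbhd G S ∧
      H.induce (closedNbhd G S) = G.induce (closedNbhd G S) := by
  constructor
  · ext x
    constructor
    · rintro (hx | ⟨w, hw, hwx⟩)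
      · exact Or.inl hx
      · refine Or.inr ⟨w, hw, ?_⟩
        by_contra hn
        exact (h w x hwx hn).1 hw
    · rintro (hx | ⟨w, hw, hwx⟩)
      · exact Or.inl hx
      · exact Or.inr ⟨w, hw, hGH hwx⟩
  · ext x y
    simp only [SimpleGraph.comap_adj, Function.Embedding.subtype_apply]
    constructor
    · intro hxy
      by_contra hn
      exact (h _ _ hxy hn).2 ⟨x.2, y.2⟩
    · exact fun hxy => hGH hxy

/-- A small set of vertices of the gadget graph admits a Hamiltonian supergraph that does not
differ near the set. -/
theorem exists_isHamiltonian_ge_gadgetGraph {d : ℕ} (hd : 2 ≤ d) {V : Type u} [Fintype V]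
    [DecidableEq V] [Nonempty V] {E : SimpleGraph V} [DecidableRel E.Adj]
    (hreg : E.IsRegularOfDegree d) (hexp : 1 ≤ expansionRatio E)
    (f : E.Dart ≃ Fin (Fintype.card E.Dart)) [DecidableEq (GadgetVertex E)]
    (S : Finset (GadgetVertex E)) (hS : (S.card : ℝ) ≤
      1 / (2 * (6 + 31 * (d : ℝ))) * (Fintype.card (GadgetVertex E) : ℝ)) :
    ∃ H : SimpleGraph (GadgetVertex E),
      gadgetGraph E f ≤ H ∧ boundedDegree (d + 3) (GadgetVertex E) H ∧ H.IsHamiltonian ∧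
      ∀ x y, H.Adj x y → ¬ (gadgetGraph E f).Adj x y →
        x ∉ S ∧ y ∉ S ∧
        ¬ (x ∈ closedNbhd (gadgetGraph E f) (S : Set (GadgetVertex E)) ∧
           y ∈ closedNbhd (gadgetGraph E f) (S : Set (GadgetVertex E))) := by
  have hS2 : 2 * S.card ≤ Fintype.card V := by
    have hc : Fintype.card E.Dart = d * Fintype.card V := by
      rw [E.dart_card_eq_sum_degrees, Finset.sum_congr rfl fun v _ => hreg v, Finset.sum_const,
        Finset.card_univ, smul_eq_mul, mul_comm]
    rw [card_gadgetVertex, hc] at hS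
    have hpos : (0 : ℝ) < 6 + 31 * (d : ℝ) := by positivity
    rw [one_div, inv_mul_eq_div, le_div_iff₀ (by positivity)] at hS
    push_cast at hS
    have : (2 * S.card : ℝ) ≤ Fintype.card V := by
      refine le_of_mul_le_mul_right ?_ hpos
      linarith
    exact_mod_cast this
  set X : Finset V := S.image baseVertex with hX
  have hXS : X.card ≤ S.card := Finset.card_image_le
  obtain ⟨R⟩ := exists_routing (by omega) hreg (X := X) fun X' hX' hne =>
    card_le_edgeBoundaryCard hexp hne (by have := Finset.card_le_card hX'; omega)
  have hle : gadgetGraph E f ≤ R.augmentedGraph f := le_sup_left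
  have hSX : ∀ x ∈ S, baseVertex x ∈ X := fun x hx => Finset.mem_image_of_mem _ hx
  refine ⟨R.augmentedGraph f, hle, R.augmentedGraph_boundedDegree f hd hreg,
    R.augmentedGraph_isHamiltonian f, fun x y hxy hn => ?_⟩
  have hadd : s(x, y) ∈ R.addedEdges := by
    rw [Routing.augmentedGraph, SimpleGraph.sup_adj, SimpleGraph.fromEdgeSet_adj] at hxy
    exact (hxy.resolve_left hn).1
  obtain ⟨hx, hy, hfar⟩ := R.addedEdges_far f hadd
  have hnot : ∀ p, baseVertex p ∉ X → (∀ z, (R.augmentedGraph f).Adj p z → baseVertex z ∉ X) →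
      p ∉ closedNbhd (gadgetGraph E f) (S : Set (GadgetVertex E)) := by
    rintro p hp hz (h | ⟨w, hw, h⟩)
    · exact hp (hSX p h)
    · exact hz w (hle h.symm) (hSX w hw)
  refine ⟨fun h => hx (hSX x h), fun h => hy (hSX y h), fun h => ?_⟩
  rcases hfar with hfar | hfar
  · exact hnot x hx hfar h.1
  · exact hnot y hy hfar h.2

theorem mainTheorem3 (d : ℕ) (hd : 2 ≤ d) {V : Type u} [Fintype V] [DecidableEq V] [Nonempty V]
    (E : SimpleGraph V) [DecidableRel E.Adj] (hreg : E.IsRegularOfDegree d)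
    (hexp : 1 ≤ expansionRatio E) (f : E.Dart ≃ Fin (Fintype.card E.Dart)) :
    IsLocallyHamiltonianOn (boundedDegree (d + 3)) (1 / (2 * (6 + 31 * (d : ℝ))))
      (gadgetGraph E f) ∧
    ∀ S : Finset (GadgetVertex E),
      (S.card : ℝ) ≤ 1 / (2 * (6 + 31 * (d : ℝ))) * (Fintype.card (GadgetVertex E) : ℝ) →
      ∃ H : SimpleGraph (GadgetVertex E),
        gadgetGraph E f ≤ H ∧ boundedDegree (d + 3) (GadgetVertex E) H ∧ H.IsHamiltonian ∧
        ∀ x y, H.Adj x y → ¬ (gadgetGraph E f).Adj x y →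
          x ∉ S ∧ y ∉ S ∧
          ¬ (x ∈ closedNbhd (gadgetGraph E f) (S : Set (GadgetVertex E)) ∧
             y ∈ closedNbhd (gadgetGraph E f) (S : Set (GadgetVertex E))) := by
  refine ⟨⟨by positivity, ?_, ?_, ?_⟩, exists_isHamiltonian_ge_gadgetGraph hd hreg hexp f⟩
  · rw [div_le_one (by positivity)]
    have : (0 : ℝ) ≤ d := Nat.cast_nonneg d
    linarith
  · intro x
    obtain ⟨H, hle, hdeg, -⟩ := exists_isHamiltonian_ge_gadgetGraph hd hreg hexp f ∅ (by
      rw [Finset.card_empty, Nat.cast_zero]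
      positivity)
    exact (Set.ncard_le_ncard (fun y hy => hle hy) (Set.toFinite _)).trans (hdeg x)
  · intro S hS
    classical
    obtain ⟨H, hle, hdeg, hham, hfar⟩ := exists_isHamiltonian_ge_gadgetGraph hd hreg hexp f S hS
    obtain ⟨hN, hind⟩ := closedNbhd_and_induce_eq hle (S := (S : Set (GadgetVertex E)))
      fun x y hxy hn => ⟨(hfar x y hxy hn).1, (hfar x y hxy hn).2.2⟩
    refine ⟨GadgetVertex E, inferInstance, H, hdeg, by convert hham, rfl, S, ?_⟩
    rw [hN, hind]
    refine ⟨SimpleGraph.Iso.refl, ?_⟩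
    ext x
    constructor
    · rintro ⟨y, hy, rfl⟩
      exact hy
    · intro hx
      exact ⟨⟨x, Or.inl hx⟩, hx, rfl⟩
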